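/- Let $\lambda\colon[0,\infty)\to(0,\infty)$ be continuous with $\frac1\lambda\notin L^1(0,\infty)$. Let $L^2_\lambda(0,\infty)$ be the Hilbert space of (classes of) measurable functions $x\colon(0,\infty)\to\mathbb{C}$ with $\|x\|^2=\int_0^\infty\lambda(\xi)|x(\xi)|^2\,d\xi<\infty$. Put $p_\lambda(\xi)=\int_0^\xi\lambda(\zeta)^{-1}\,d\zeta$ for $\xi\geqslant0$. Then $p_\lambda\colon[0,\infty)\to[0,\infty)$ is bijective, so that $\mu_\lambda(\xi,t):=p_\lambda^{-1}(p_\lambda(\xi)+t)-\xi$ is well defined for $\xi,t\geqslant0$. Moreover, the operator $A_\lambda\colon D(A_\lambda)\subseteq L^2_\lambda(0,\infty)\to L^2_\lambda(0,\infty)$, $$A_\lambda x=(\lambda x)',\qquad D(A_\lambda)=\bigl\{x\in L^2_\lambda(0,\infty)\;:\;\lambda x\in \mathrm{AC}_{\mathrm{loc}}[0,\infty)\text{ and }(\lambda x)'\in L^2_\lambda(0,\infty)\bigr\}$$ (no boundary condition at $0$), generates the $C_0$-semigroup $(T_\lambda(t))_{t\geqslant0}$ of bounded operators on $L^2_\lambda(0,\infty)$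 given, for $x\in L^2_\lambda(0,\infty)$, $t\geqslant0$ and almost every $\xi>0$, by $$(T_\lambda(t)x)(\xi)=\frac{\lambda(\xi+\mu_\lambda(\xi,t))}{\lambda(\xi)}\,x(\xi+\mu_\lambda(\xi,t)).$$ Here $\lambda x\in\mathrm{AC}_{\mathrm{loc}}[0,\infty)$ means that $\lambda x$ agrees almost everywhere with a function that is absolutely continuous on every compact interval $[a,b]\subseteq[0,\infty)$, and $(\lambda x)'$ is its almost everywhere defined derivative. -/

import Mathlib

open MeasureTheory Set Filter Topology
open scoped NNReal ENNReal

namespace WeightedTransport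

noncomputable section

/-! ## Strongly continuous semigroups and their generators -/

section Semigroup

variable {X : Type*} [NormedAddCommGroup X] [NormedSpace ℂ X]

/-- `(T(t))_{t ≥ 0}` is a `C₀`-semigroup of bounded operators on `X`: it satisfies `T(0) = 1` and
`T(s + t) = T(s) T(t)`, and all orbits `t ↦ T(t) x` are norm continuous on `[0, ∞)`. -/
structure IsC0Semigroup (T : ℝ≥0 → X →L[ℂ] X) : Prop where
  map_zero : T 0 = ContinuousLinearMap.id ℂ X
  map_add : ∀ s t : ℝ≥0, T (s + t) = (T s).comp (T t)
  continuous_orbit : ∀ x : X, Continuous fun t : ℝ≥0 => T t x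

/-- The unbounded operator `A` is the infinitesimal generator of `(T(t))_{t ≥ 0}`: for all `x` and
`z`, one has `x ∈ D(A)` and `A x = z` if and only if `(T(t) x - x) / t → z` in norm as `t ↘ 0`.
In particular `D(A)` consists of exactly those `x` for which this limit exists. -/
def IsGeneratorOf (A : X →ₗ.[ℂ] X) (T : ℝ≥0 → X →L[ℂ] X) : Prop :=
  ∀ x z : X, (x, z) ∈ A.graph ↔
    Tendsto (fun t : ℝ≥0 => ((t : ℝ)⁻¹ : ℂ) • (T t x - x)) (𝓝[>] 0) (𝓝 z)

end Semigroup

/-! ## The weighted space and the weighted transport operator -/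

/-- Lebesgue measure on the open half-line `(0, ∞)`. -/
abbrev halfLine : Measure ℝ := volume.restrict (Ioi 0)

/-- The measure `lam(ξ) dξ` on `(0, ∞)`. -/
def weighted (lam : ℝ → ℝ) : Measure ℝ := halfLine.withDensity fun ξ => ENNReal.ofReal (lam ξ)

/-- The weighted space `L²_lam(0, ∞)` of (classes of) complex valued functions `x` such that
`∫_0^∞ lam(ξ) |x(ξ)|² dξ < ∞`. -/
abbrev L2 (lam : ℝ → ℝ) : Type := Lp ℂ 2 (weighted lam)

/-- `y` is locally absolutely continuous on `I`: it is absolutely continuous on every compact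
interval `[a, b] ⊆ I`. -/
def LocallyAC (y : ℝ → ℂ) (I : Set ℝ) : Prop :=
  ∀ a b : ℝ, a ≤ b → Icc a b ⊆ I → AbsolutelyContinuousOnInterval y a b

/-- `y` is a locally absolutely continuous function on `[0, ∞)` that represents `lam x` and whose
almost everywhere defined derivative belongs to `L²_lam(0, ∞)`. -/
structure IsACRep (lam : ℝ → ℝ) (x : L2 lam) (y : ℝ → ℂ) : Prop where
  locallyAC : LocallyAC y (Ici 0)
  ae_eq : ∀ᵐ ξ ∂halfLine, y ξ = (lam ξ : ℂ) * x ξ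
  memLp_deriv : MemLp (deriv y) 2 (weighted lam)

variable {lam : ℝ → ℝ}

theorem weighted_ac : weighted lam ≪ halfLine :=
  withDensity_absolutelyContinuous _ _

theorem ac_weighted (hc : ContinuousOn lam (Ici 0)) (hpos : ∀ ξ, 0 ≤ ξ → 0 < lam ξ) :
    halfLine ≪ weighted lam := by
  refine withDensity_absolutelyContinuous' ?_ ?_
  · exact ((hc.mono Ioi_subset_Ici_self).aemeasurable measurableSet_Ioi).ennreal_ofReal
  · filter_upwards [ae_restrict_mem measurableSet_Ioi] with ξ hξ
    exact (ENNReal.ofReal_pos.2 (hpos ξ (le_of_lt hξ))).ne'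

theorem LocallyAC.continuousOn {y : ℝ → ℂ} (h : LocallyAC y (Ici 0)) :
    ContinuousOn y (Ioi 0) := by
  intro ξ hξ
  have h0 : (0 : ℝ) < ξ := hξ
  have h1 := (h 0 (ξ + 1) (by linarith) Icc_subset_Ici_self).continuousOn
  rw [uIcc_of_le (by linarith)] at h1
  exact (h1.continuousAt (Icc_mem_nhds h0 (by linarith))).continuousWithinAt

theorem LocallyAC.ae_differentiableAt {y : ℝ → ℂ} (h : LocallyAC y (Ici 0)) :
    ∀ᵐ ξ ∂halfLine, DifferentiableAt ℝ y ξ := by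
  have h1 : ∀ n : ℕ, ∀ᵐ ξ : ℝ, ξ ∈ uIcc (0 : ℝ) n → DifferentiableAt ℝ y ξ := fun n =>
    (h 0 n n.cast_nonneg Icc_subset_Ici_self).boundedVariationOn.ae_differentiableAt_of_mem_uIcc
  rw [ae_restrict_iff' measurableSet_Ioi]
  filter_upwards [ae_all_iff.2 h1] with ξ hξ h0
  obtain ⟨n, hn⟩ := exists_nat_ge ξ
  exact hξ n (by rw [uIcc_of_le n.cast_nonneg]; exact ⟨le_of_lt h0, hn⟩)

/-- The class of the derivative does not depend on the chosen representative of `lam x`. -/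
theorem IsACRep.deriv_ae_eq {x : L2 lam} {y z : ℝ → ℂ} (hy : IsACRep lam x y)
    (hz : IsACRep lam x z) : ∀ᵐ ξ ∂halfLine, deriv y ξ = deriv z ξ := by
  have h : EqOn y z (Ioi 0) := by
    refine Measure.eqOn_open_of_ae_eq (μ := volume) ?_ isOpen_Ioi hy.locallyAC.continuousOn
      hz.locallyAC.continuousOn
    filter_upwards [hy.ae_eq, hz.ae_eq] with ξ h1 h2
    rw [h1, h2]
  filter_upwards [ae_restrict_mem measurableSet_Ioi] with ξ hξ
  exact (h.eventuallyEq_of_mem (isOpen_Ioi.mem_nhds hξ)).deriv_eq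

theorem IsACRep.add (hc : ContinuousOn lam (Ici 0)) (hpos : ∀ ξ, 0 ≤ ξ → 0 < lam ξ)
    {x₁ x₂ : L2 lam} {y₁ y₂ : ℝ → ℂ} (h₁ : IsACRep lam x₁ y₁) (h₂ : IsACRep lam x₂ y₂) :
    IsACRep lam (x₁ + x₂) (y₁ + y₂) ∧
      ∀ᵐ ξ ∂halfLine, deriv (y₁ + y₂) ξ = deriv y₁ ξ + deriv y₂ ξ := by
  have hd : ∀ᵐ ξ ∂halfLine, deriv (y₁ + y₂) ξ = deriv y₁ ξ + deriv y₂ ξ := by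
    filter_upwards [h₁.locallyAC.ae_differentiableAt, h₂.locallyAC.ae_differentiableAt]
      with ξ a b
    exact deriv_add a b
  refine ⟨⟨fun a b hab hI => (h₁.locallyAC a b hab hI).add (h₂.locallyAC a b hab hI), ?_, ?_⟩, hd⟩
  · filter_upwards [h₁.ae_eq, h₂.ae_eq, ac_weighted hc hpos (Lp.coeFn_add x₁ x₂)] with ξ a b c
    rw [Pi.add_apply, a, b, c, Pi.add_apply, mul_add]
  · refine (h₁.memLp_deriv.add h₂.memLp_deriv).ae_eq ?_
    filter_upwards [weighted_ac hd] with ξ a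
    exact a.symm

theorem IsACRep.smul (hc : ContinuousOn lam (Ici 0)) (hpos : ∀ ξ, 0 ≤ ξ → 0 < lam ξ)
    (c : ℂ) {x : L2 lam} {y : ℝ → ℂ} (h : IsACRep lam x y) :
    IsACRep lam (c • x) (fun ξ => c • y ξ) ∧
      ∀ᵐ ξ ∂halfLine, deriv (fun ξ => c • y ξ) ξ = c • deriv y ξ := by
  have hd : ∀ᵐ ξ ∂halfLine, deriv (fun ξ => c • y ξ) ξ = c • deriv y ξ := by
    filter_upwards [h.locallyAC.ae_differentiableAt] with ξ a
    exact deriv_fun_const_smul c a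
  refine ⟨⟨fun a b hab hI => (h.locallyAC a b hab hI).const_smul c, ?_, ?_⟩, hd⟩
  · filter_upwards [h.ae_eq, ac_weighted hc hpos (Lp.coeFn_smul c x)] with ξ a b
    rw [a, b, Pi.smul_apply, smul_eq_mul, smul_eq_mul, mul_left_comm]
  · refine (h.memLp_deriv.const_smul c).ae_eq ?_
    filter_upwards [weighted_ac hd] with ξ a
    exact a.symm

theorem isACRep_zero (hc : ContinuousOn lam (Ici 0)) (hpos : ∀ ξ, 0 ≤ ξ → 0 < lam ξ) :
    IsACRep lam 0 0 := by
  refine ⟨fun a b _ _ => ?_, ?_, ?_⟩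
  · have h := (contDiff_const (𝕜 := ℝ) (n := 1) (c := (0 : ℂ))).contDiffOn (s := uIcc a b)
    exact h.absolutelyContinuousOnInterval
  · filter_upwards [ac_weighted hc hpos (Lp.coeFn_zero ℂ 2 (weighted lam))] with ξ a
    rw [a]; simp
  · have : deriv (0 : ℝ → ℂ) = 0 := by ext ξ; exact deriv_const ξ 0
    rw [this]; exact MemLp.zero

/-- The operator `A_lam x = (lam x)'` on `L²_lam(0, ∞)` with domain
`{x ∈ L²_lam(0, ∞) : lam x ∈ AC_loc[0, ∞) and (lam x)' ∈ L²_lam(0, ∞)}`. -/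
def transportOperator (lam : ℝ → ℝ) (hc : ContinuousOn lam (Ici 0))
    (hpos : ∀ ξ, 0 ≤ ξ → 0 < lam ξ) : L2 lam →ₗ.[ℂ] L2 lam where
  domain :=
    { carrier := {x | ∃ y : ℝ → ℂ, IsACRep lam x y}
      add_mem' := fun ⟨_, h₁⟩ ⟨_, h₂⟩ => ⟨_, (h₁.add hc hpos h₂).1⟩
      zero_mem' := ⟨_, isACRep_zero hc hpos⟩
      smul_mem' := fun c _ ⟨_, h⟩ => ⟨_, (h.smul hc hpos c).1⟩ }
  toFun :=
    { toFun := fun x => x.2.choose_spec.memLp_deriv.toLp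
      map_add' := by
        intro x₁ x₂
        obtain ⟨h, hd⟩ := x₁.2.choose_spec.add hc hpos x₂.2.choose_spec
        rw [← MemLp.toLp_add]
        refine (MemLp.toLp_eq_toLp_iff _ _).2 (weighted_ac ?_)
        filter_upwards [(x₁ + x₂).2.choose_spec.deriv_ae_eq h, hd] with ξ a b
        rw [a, b, Pi.add_apply]
      map_smul' := by
        intro c x
        obtain ⟨h, hd⟩ := x.2.choose_spec.smul hc hpos c
        rw [RingHom.id_apply, ← MemLp.toLp_const_smul]
        refine (MemLp.toLp_eq_toLp_iff _ _).2 (weighted_ac ?_)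
        filter_upwards [(c • x).2.choose_spec.deriv_ae_eq h, hd] with ξ a b
        rw [a, b, Pi.smul_apply] }

/-- The operator is given by `x ∈ D(A_lam)` and `A_lam x = z` if and only if `lam x` has a locally
absolutely continuous representative on `[0, ∞)` whose derivative is `z` almost everywhere. -/
theorem mem_graph_transportOperator (hc : ContinuousOn lam (Ici 0))
    (hpos : ∀ ξ, 0 ≤ ξ → 0 < lam ξ) (x z : L2 lam) :
    (x, z) ∈ (transportOperator lam hc hpos).graph ↔
      ∃ y : ℝ → ℂ, LocallyAC y (Ici 0) ∧ (∀ᵐ ξ ∂halfLine, y ξ = (lam ξ : ℂ) * x ξ) ∧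
        ∀ᵐ ξ ∂halfLine, deriv y ξ = z ξ := by
  rw [LinearPMap.mem_graph_iff]
  constructor
  · rintro ⟨x', rfl, hz⟩
    have h := x'.2.choose_spec
    refine ⟨_, h.locallyAC, h.ae_eq, ac_weighted hc hpos ?_⟩
    have h1 : z = h.memLp_deriv.toLp := hz.symm
    rw [h1]
    exact h.memLp_deriv.coeFn_toLp.symm
  · rintro ⟨y, h1, h2, h3⟩
    have h : IsACRep lam x y :=
      ⟨h1, h2, (Lp.memLp z).ae_eq (by filter_upwards [weighted_ac h3] with ξ a using a.symm)⟩
    refine ⟨⟨x, y, h⟩, rfl, ?_⟩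
    have hx : ∃ y : ℝ → ℂ, IsACRep lam x y := ⟨y, h⟩
    change hx.choose_spec.memLp_deriv.toLp = z
    refine Lp.ext (hx.choose_spec.memLp_deriv.coeFn_toLp.trans (weighted_ac ?_))
    filter_upwards [hx.choose_spec.deriv_ae_eq h, h3] with ξ a b
    rw [a, b]

/-! ## The characteristics -/

/-- `p_lam(ξ) = ∫_0^ξ lam(ζ)⁻¹ dζ`. -/
def travelTime (lam : ℝ → ℝ) (ξ : ℝ) : ℝ := ∫ ζ in (0 : ℝ)..ξ, (lam ζ)⁻¹

/-- The inverse of `p_lam : [0, ∞) → [0, ∞)`. -/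
def travelTimeInv (lam : ℝ → ℝ) : ℝ → ℝ := Function.invFunOn (travelTime lam) (Ici 0)

/-- `μ_lam(ξ, t) = p_lam⁻¹(p_lam(ξ) + t) - ξ`. -/
def displacement (lam : ℝ → ℝ) (ξ t : ℝ) : ℝ := travelTimeInv lam (travelTime lam ξ + t) - ξ

end

end WeightedTransport

namespace WeightedTransport

/-! Use the clock s = P(ξ), where P extends `travelTime` to an order automorphism of ℝ;
non-integrability of 1/λ is what makes P map [0, ∞) onto itself. Since ds = dξ/λ, the map x ↦ w =
(λx) ∘ P⁻¹ is an isometry of L²_λ onto L²(0, ∞): ∫ |w|² ds = ∫ λ|x|² dξ. It turns A_λ into d/ds and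
the stated semigroup into left translation, which brings in no data from the boundary. Extending w
by 0 (`pull`) and restricting back (`push`) gives access to the translations of L²(ℝ), and strong
continuity of `flow` is inherited from them.

The generator is identified by two inclusions. If λx has derivative z, the difference quotient minus
z is the `push` of the average over r ∈ (0, t) of w(· + r) - w, where w = `pull z`; its norm is at
most the largest of these translation differences, which tends to 0 (`enorm_quotient_sub_le`).
Conversely, if the quotients converge to z, integrating them over [a, b] produces difference
quotients of r ↦ ∫_0^r `pull x` at b and at a. At Lebesgue points the limit gives `pull x b - pull x
a = ∫ pull z` (`integral_eq_sub_of_tendsto`), so λx is almost everywhere a constant plus an integral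
of z. -/

/-! ### L² estimates -/

theorem eLpNorm_two_sq {α : Type*} [MeasurableSpace α] (μ : Measure α) (f : α → ℂ) :
    eLpNorm f 2 μ ^ 2 = ∫⁻ a, ‖f a‖ₑ ^ 2 ∂μ := by
  have h := eLpNorm_nnreal_pow_eq_lintegral (μ := μ) (f := f) (p := 2) two_ne_zero
  simpa using h

theorem enorm_sq_eq_lintegral {α : Type*} [MeasurableSpace α] {μ : Measure α} (x : Lp ℂ 2 μ) :
    ‖x‖ₑ ^ 2 = ∫⁻ a, ‖x a‖ₑ ^ 2 ∂μ := by
  rw [Lp.enorm_def, eLpNorm_two_sq]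

/-- A weighted composition operator `x ↦ m · (x ∘ φ)` that does not increase the `L²` norm. -/
theorem exists_weightedComp {α β : Type*} [MeasurableSpace α] [MeasurableSpace β]
    {μ : Measure α} {ν : Measure β} {φ : β → α} {m : β → ℂ}
    (hφ : Measurable φ) (hm : AEStronglyMeasurable m ν)
    (hae : ∀ p : α → Prop, (∀ᵐ a ∂μ, p a) → ∀ᵐ b ∂ν, m b ≠ 0 → p (φ b))
    (hle : ∀ f : α → ℂ, ∫⁻ b, ‖m b * f (φ b)‖ₑ ^ 2 ∂ν ≤ ∫⁻ a, ‖f a‖ₑ ^ 2 ∂μ) :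
    ∃ W : Lp ℂ 2 μ →L[ℂ] Lp ℂ 2 ν, ∀ x, ∀ᵐ b ∂ν, W x b = m b * x (φ b) := by
  have hn : ∀ f : α → ℂ, eLpNorm (fun b => m b * f (φ b)) 2 ν ≤ eLpNorm f 2 μ := fun f => by
    rw [← ENNReal.pow_le_pow_left_iff two_ne_zero, eLpNorm_two_sq, eLpNorm_two_sq]
    exact hle f
  have hmem : ∀ x : Lp ℂ 2 μ, MemLp (fun b => m b * x (φ b)) 2 ν := fun x =>
    ⟨hm.mul ((Lp.stronglyMeasurable x).comp_measurable hφ).aestronglyMeasurable,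
      (hn x).trans_lt (Lp.memLp x).2⟩
  let W : Lp ℂ 2 μ →ₗ[ℂ] Lp ℂ 2 ν :=
    { toFun := fun x => (hmem x).toLp
      map_add' := fun x y => by
        rw [← MemLp.toLp_add, MemLp.toLp_eq_toLp_iff]
        -- Almost everywhere identities transfer along φ only where m ≠ 0; elsewhere both sides
        -- vanish.
        filter_upwards [hae _ (Lp.coeFn_add x y)] with b hb
        rcases eq_or_ne (m b) 0 with h0 | h0
        · simp [h0]
        · simp only [Pi.add_apply, hb h0, mul_add]
      map_smul' := fun c x => by
        rw [RingHom.id_apply, ← MemLp.toLp_const_smul, MemLp.toLp_eq_toLp_iff]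
        filter_upwards [hae _ (Lp.coeFn_smul c x)] with b hb
        rcases eq_or_ne (m b) 0 with h0 | h0
        · simp [h0]
        · simp only [Pi.smul_apply, hb h0, smul_eq_mul, mul_left_comm] }
  refine ⟨W.mkContinuous 1 fun x => ?_, fun x => (hmem x).coeFn_toLp⟩
  rw [one_mul]
  change ‖(hmem x).toLp‖ ≤ _
  rw [Lp.norm_toLp, Lp.norm_def]
  exact ENNReal.toReal_mono (Lp.memLp x).2.ne (hn x)

/-- Cauchy–Schwarz against the constant 1 on an interval of length t. -/
theorem enorm_intervalIntegral_sq_le {g : ℝ → ℂ} {t : ℝ} (ht : 0 ≤ t)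
    (hg : AEStronglyMeasurable g (volume.restrict (Ioc 0 t))) :
    ‖∫ r in (0 : ℝ)..t, g r‖ₑ ^ 2 ≤ ENNReal.ofReal t * ∫⁻ r in Ioc 0 t, ‖g r‖ₑ ^ 2 := by
  have h := eLpNorm_le_eLpNorm_mul_rpow_measure_univ (p := 1) (q := 2) one_le_two hg
  have h1 : ‖∫ r in (0 : ℝ)..t, g r‖ₑ ≤ eLpNorm g 1 (volume.restrict (Ioc 0 t)) := by
    rw [intervalIntegral.integral_of_le ht, eLpNorm_one_eq_lintegral_enorm]
    exact enorm_integral_le_lintegral_enorm _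
  refine (pow_le_pow_left' (h1.trans h) 2).trans_eq ?_
  rw [mul_pow, eLpNorm_two_sq, mul_comm, ← ENNReal.rpow_natCast, ← ENNReal.rpow_mul]
  norm_num

/-- The average over `r ∈ (0, t)` of the differences `w (· + r) - w` is at most as large in `L²` as
the largest of these differences. -/
theorem lintegral_average_translate_le {w : ℝ → ℂ} (hw : Measurable w) {t : ℝ} (ht : 0 < t)
    {C : ℝ≥0∞} (hC : ∀ r ∈ Ioc 0 t, ∫⁻ s, ‖w (s + r) - w s‖ₑ ^ 2 ≤ C) :
    ∫⁻ s, ‖(t : ℂ)⁻¹ * ∫ r in (0 : ℝ)..t, (w (s + r) - w s)‖ₑ ^ 2 ≤ C := by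
  have ht' : ‖(t : ℂ)⁻¹‖ₑ = (ENNReal.ofReal t)⁻¹ := by
    rw [enorm_inv (by exact_mod_cast ht.ne'), ← ofReal_norm, Complex.norm_of_nonneg ht.le]
  have h0 : ENNReal.ofReal t ≠ 0 := (ENNReal.ofReal_pos.2 ht).ne'
  have hm : Measurable fun p : ℝ × ℝ => ‖w (p.1 + p.2) - w p.1‖ₑ ^ 2 := by fun_prop
  calc ∫⁻ s, ‖(t : ℂ)⁻¹ * ∫ r in (0 : ℝ)..t, (w (s + r) - w s)‖ₑ ^ 2
      -- Cauchy–Schwarz in r turns t⁻² into t⁻² · t = t⁻¹; Tonelli then exchanges r and s.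
      ≤ ∫⁻ s, (ENNReal.ofReal t)⁻¹ * ∫⁻ r in Ioc 0 t, ‖w (s + r) - w s‖ₑ ^ 2 := by
        refine lintegral_mono fun s => ?_
        rw [enorm_mul, mul_pow, ht']
        have h := enorm_intervalIntegral_sq_le (g := fun r => w (s + r) - w s) ht.le
          (by
            have : Measurable fun r => w (s + r) - w s := by fun_prop
            exact this.aestronglyMeasurable)
        refine (mul_le_mul_right h _).trans_eq ?_
        rw [← mul_assoc, sq, mul_assoc _ _ (ENNReal.ofReal t),
          ENNReal.inv_mul_cancel h0 ENNReal.ofReal_ne_top, mul_one]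
    _ = (ENNReal.ofReal t)⁻¹ * ∫⁻ r in Ioc 0 t, ∫⁻ s, ‖w (s + r) - w s‖ₑ ^ 2 := by
        rw [lintegral_const_mul _ (Measurable.lintegral_prod_right' hm),
          lintegral_lintegral_swap hm.aemeasurable]
    _ ≤ (ENNReal.ofReal t)⁻¹ * ∫⁻ r in Ioc 0 t, C := by
        exact mul_le_mul_right (setLIntegral_mono measurable_const hC) _
    _ = C := by
        rw [setLIntegral_const, Real.volume_Ioc, sub_zero, mul_comm C, ← mul_assoc,
          ENNReal.inv_mul_cancel h0 ENNReal.ofReal_ne_top, one_mul]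

/-! ### Absolute continuity of complex valued functions -/

theorem absolutelyContinuousOnInterval_ofReal_comp {f : ℝ → ℝ} {a b : ℝ}
    (hf : AbsolutelyContinuousOnInterval f a b) :
    AbsolutelyContinuousOnInterval (fun r => (f r : ℂ)) a b := by
  have h : ∀ r s : ℝ, dist (r : ℂ) (s : ℂ) = dist r s := Complex.isometry_ofReal.dist_eq
  simpa only [AbsolutelyContinuousOnInterval, h] using hf

/-- The real and imaginary parts are treated separately and recombined. -/
theorem absolutelyContinuousOnInterval_integral {f : ℝ → ℂ} {a b c : ℝ}
    (h : IntervalIntegrable f volume a b) (hc : c ∈ uIcc a b) :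
    AbsolutelyContinuousOnInterval (fun r => ∫ v in c..r, f v) a b := by
  have hre : IntervalIntegrable (fun v => (f v).re) volume a b := ⟨h.1.re, h.2.re⟩
  have him : IntervalIntegrable (fun v => (f v).im) volume a b := ⟨h.1.im, h.2.im⟩
  have h1 := (absolutelyContinuousOnInterval_ofReal_comp
      (hre.absolutelyContinuousOnInterval_intervalIntegral hc)).add
    ((absolutelyContinuousOnInterval_ofReal_comp
      (him.absolutelyContinuousOnInterval_intervalIntegral hc)).const_smul Complex.I)
  -- Absolute continuity only tests subintervals with endpoints in `uIcc a b`, so agreement there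
  -- suffices.
  refine h1.congr' ?_
  have hmem : ∀ᶠ e in (AbsolutelyContinuousOnInterval.totalLengthFilter ⊓
      𝓟 (AbsolutelyContinuousOnInterval.disjWithin a b)),
      e ∈ AbsolutelyContinuousOnInterval.disjWithin a b := eventually_inf_principal.2 (by simp)
  have key : ∀ r ∈ uIcc a b, ((fun r => ((∫ v in c..r, (f v).re : ℝ) : ℂ)) +
      fun r => Complex.I • ((∫ v in c..r, (f v).im : ℝ) : ℂ)) r = ∫ v in c..r, f v := by
    intro r hr
    have hi : IntervalIntegrable f volume c r := h.mono_set (uIcc_subset_uIcc hc hr)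
    rw [Pi.add_apply, ← intervalIntegral.integral_ofReal, ← intervalIntegral.integral_ofReal,
      ← intervalIntegral.integral_smul, ← intervalIntegral.integral_add]
    · congr 1
      ext v
      rw [smul_eq_mul, mul_comm]
      exact Complex.re_add_im (f v)
    · exact ⟨hi.1.re.ofReal, hi.2.re.ofReal⟩
    · exact (show IntervalIntegrable (fun v => ((f v).im : ℂ)) volume c r from
        ⟨hi.1.im.ofReal, hi.2.im.ofReal⟩).smul Complex.I
  filter_upwards [hmem] with e he
  refine Finset.sum_congr rfl fun i hi => ?_
  rw [key _ (he.1 i hi).1, key _ (he.1 i hi).2]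

/-- Subtracting the primitive of g from f leaves an absolutely continuous function with derivative
zero almost everywhere, hence a constant. -/
theorem sub_eq_integral_of_ae_hasDerivAt {f g : ℝ → ℂ} {a b : ℝ}
    (hf : AbsolutelyContinuousOnInterval f a b) (hg : IntervalIntegrable g volume a b)
    (hd : ∀ᵐ r, r ∈ uIcc a b → HasDerivAt f (g r) r) : f b - f a = ∫ v in a..b, g v := by
  obtain ⟨C, hC⟩ := (hf.sub
    (absolutelyContinuousOnInterval_integral hg left_mem_uIcc)).const_of_ae_hasDerivAt_zero (by
      filter_upwards [hd, hg.ae_hasDerivAt_integral] with r h1 h2 hr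
      simpa using (h1 hr).sub (h2 hr a left_mem_uIcc))
  have ha := hC a left_mem_uIcc
  have hb := hC b right_mem_uIcc
  simp only [Pi.sub_apply, intervalIntegral.integral_same, sub_zero] at ha hb
  rw [ha, ← hb]
  ring

/-! ### Translations of L²(ℝ) -/

/-- Translation by `t` on `L²(ℝ)`. -/
noncomputable def translation (t : ℝ) :
    Lp ℂ 2 (volume : Measure ℝ) →L[ℂ] Lp ℂ 2 (volume : Measure ℝ) :=
  (Lp.compMeasurePreservingₗᵢ ℂ (fun s : ℝ => s + t)
    (measurePreserving_add_right volume t)).toContinuousLinearMap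

theorem translation_ae (t : ℝ) (g : Lp ℂ 2 (volume : Measure ℝ)) :
    ∀ᵐ s, translation t g s = g (s + t) :=
  Lp.coeFn_compMeasurePreserving g (measurePreserving_add_right volume t)

theorem continuous_translation (g : Lp ℂ 2 (volume : Measure ℝ)) :
    Continuous fun t : ℝ => translation t g := by
  let F : C(ℝ × ℝ, ℝ) := ⟨fun p => p.2 + p.1, by fun_prop⟩
  exact (continuous_const (y := g)).compMeasurePreservingLp F.curry.continuous
    (fun t => measurePreserving_add_right volume t) (by simp)

theorem translation_zero (g : Lp ℂ 2 (volume : Measure ℝ)) : translation 0 g = g := by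
  refine Lp.ext ?_
  filter_upwards [translation_ae 0 g] with s hs
  rw [hs, add_zero]

/-- Integration over a bounded interval is continuous on `L²(ℝ)`. -/
theorem continuous_intervalIntegral_Lp {a b : ℝ} (hab : a ≤ b) :
    Continuous fun g : Lp ℂ 2 (volume : Measure ℝ) => ∫ s in a..b, g s := by
  have h : ∀ g : Lp ℂ 2 (volume : Measure ℝ), ∫ s in a..b, g s =
      inner ℂ (indicatorConstLp 2 (measurableSet_Ioc (a := a) (b := b))
        measure_Ioc_lt_top.ne (1 : ℂ)) g := fun g => by
    rw [L2.inner_indicatorConstLp_one, intervalIntegral.integral_of_le hab]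
  simp only [h]
  fun_prop

theorem locallyIntegrable_Lp (g : Lp ℂ 2 (volume : Measure ℝ)) : LocallyIntegrable g volume :=
  (Lp.memLp g).locallyIntegrable one_le_two

/-! ### The clock -/

/-- `P` is an order automorphism of `ℝ` that fixes `0` and whose derivative on `[0, ∞)` is
`lam⁻¹`; on the negative axis it has the slope `(lam 0)⁻¹`. -/
structure IsClock (lam : ℝ → ℝ) (P : ℝ ≃o ℝ) : Prop where
  continuousOn : ContinuousOn lam (Ici 0)
  pos : ∀ ξ, 0 ≤ ξ → 0 < lam ξ
  hasDerivAt : ∀ ξ, HasDerivAt P (lam (max ξ 0))⁻¹ ξ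
  map_zero : P 0 = 0

theorem continuous_max_zero {lam : ℝ → ℝ} (hc : ContinuousOn lam (Ici 0)) :
    Continuous fun ξ => lam (max ξ 0) :=
  hc.comp_continuous (by fun_prop) fun ξ => le_max_right ξ 0

/-- The travel time is bijective, and it extends to an order automorphism of `ℝ`. -/
theorem exists_isClock {lam : ℝ → ℝ} (hc : ContinuousOn lam (Ici 0))
    (hpos : ∀ ξ : ℝ, 0 ≤ ξ → 0 < lam ξ)
    (hint : ¬ IntegrableOn (fun ξ : ℝ => 1 / lam ξ) (Ioi 0) volume) :
    ∃ P : ℝ ≃o ℝ, IsClock lam P ∧ ∀ ξ, 0 ≤ ξ → P ξ = travelTime lam ξ := by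
  -- Freezing λ at λ(0) on the negative axis makes the integrand continuous and positive on all of
  -- ℝ.
  have hL : ∀ ξ, 0 < lam (max ξ 0) := fun ξ => hpos _ (le_max_right ξ 0)
  have hcont : Continuous fun ξ => (lam (max ξ 0))⁻¹ :=
    (continuous_max_zero hc).inv₀ fun ξ => (hL ξ).ne'
  let p : ℝ → ℝ := fun ξ => ∫ ζ in (0 : ℝ)..ξ, (lam (max ζ 0))⁻¹
  have hd : ∀ ξ, HasDerivAt p (lam (max ξ 0))⁻¹ ξ := fun ξ => hcont.integral_hasStrictDerivAt 0 ξ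
    |>.hasDerivAt
  have hp0 : p 0 = 0 := intervalIntegral.integral_same
  have hmono : StrictMono p := strictMono_of_deriv_pos fun ξ => by
    rw [(hd ξ).deriv]
    exact inv_pos.2 (hL ξ)
  have hpc : Continuous p := continuous_iff_continuousAt.2 fun ξ => (hd ξ).continuousAt
  have htt : ∀ ξ, 0 ≤ ξ → p ξ = travelTime lam ξ := fun ξ hξ => by
    refine intervalIntegral.integral_congr fun ζ hζ => ?_
    rw [uIcc_of_le hξ] at hζ
    simp only [max_eq_left hζ.1]
  have htop : Tendsto p atTop atTop := by
    refine tendsto_atTop_atTop_of_monotone hmono.monotone fun b => ?_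
    -- A bounded primitive of the positive function 1/λ would make 1/λ integrable.
    by_contra! hb
    refine hint ?_
    have hi : IntegrableOn (fun ξ => (lam (max ξ 0))⁻¹) (Ioi 0) := by
      refine integrableOn_Ioi_of_intervalIntegral_norm_bounded b 0 (l := atTop) (b := id)
        (fun i => hcont.integrableOn_Ioc) tendsto_id (Eventually.of_forall fun i => ?_)
      simp only [id, Real.norm_of_nonneg (inv_nonneg.2 (hL _).le)]
      exact (hb i).le
    refine hi.congr_fun (fun ξ hξ => ?_) measurableSet_Ioi
    simp only [max_eq_left (le_of_lt (mem_Ioi.1 hξ)), one_div]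
  have hbot : Tendsto p atBot atBot := by
    have hneg : ∀ ξ ≤ 0, p ξ = ξ * (lam 0)⁻¹ := fun ξ hξ => by
      have : p ξ = ∫ ζ in (0 : ℝ)..ξ, (lam 0)⁻¹ := by
        refine intervalIntegral.integral_congr fun ζ hζ => ?_
        rw [uIcc_of_ge hξ] at hζ
        simp only [max_eq_right hζ.2]
      rw [this, intervalIntegral.integral_const, sub_zero, smul_eq_mul]
    refine (tendsto_id.atBot_mul_const (inv_pos.2 (hpos 0 le_rfl))).congr' ?_
    filter_upwards [eventually_le_atBot 0] with ξ hξ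
    exact (hneg ξ hξ).symm
  exact ⟨StrictMono.orderIsoOfSurjective p hmono (hpc.surjective htop hbot),
    ⟨hc, hpos, hd, hp0⟩, htt⟩

theorem lintegral_weighted {lam : ℝ → ℝ} (hc : ContinuousOn lam (Ici 0)) (u : ℝ → ℝ≥0∞) :
    ∫⁻ ξ, u ξ ∂weighted lam = ∫⁻ ξ in Ioi 0, ENNReal.ofReal (lam ξ) * u ξ :=
  lintegral_withDensity_eq_lintegral_mul_non_measurable₀ _
    ((hc.mono Ioi_subset_Ici_self).aemeasurable measurableSet_Ioi).ennreal_ofReal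
    (Eventually.of_forall fun _ => ENNReal.ofReal_lt_top) u

/-! ### Change of variables -/

namespace IsClock

variable {lam : ℝ → ℝ} {P : ℝ ≃o ℝ}

theorem lam_ne_zero (h : IsClock lam P) {ξ : ℝ} (hξ : 0 ≤ ξ) : (lam ξ : ℂ) ≠ 0 :=
  Complex.ofReal_ne_zero.2 (h.pos ξ hξ).ne'

theorem hasDerivAt_symm (h : IsClock lam P) (s : ℝ) :
    HasDerivAt P.symm (lam (max (P.symm s) 0)) s := by
  have hp := h.pos _ (le_max_right (P.symm s) 0)
  simpa using HasDerivAt.of_local_left_inverse P.symm.continuous.continuousAt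
    (h.hasDerivAt (P.symm s)) (inv_ne_zero hp.ne')
    (Eventually.of_forall fun y => P.apply_symm_apply y)

theorem map_nonneg (h : IsClock lam P) {ξ : ℝ} (hξ : 0 ≤ ξ) : 0 ≤ P ξ :=
  h.map_zero ▸ P.monotone hξ

theorem map_pos (h : IsClock lam P) {ξ : ℝ} (hξ : 0 < ξ) : 0 < P ξ :=
  h.map_zero ▸ P.strictMono hξ

theorem symm_pos (h : IsClock lam P) {s : ℝ} (hs : 0 < s) : 0 < P.symm s := by
  rw [← P.lt_iff_lt, P.apply_symm_apply, h.map_zero]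
  exact hs

theorem image_Ioi (h : IsClock lam P) : P '' Ioi 0 = Ioi 0 := by
  rw [P.image_Ioi, h.map_zero]

/-- A preimage under f is an image under `f.symm`, and differentiable maps send null sets to null
sets. -/
theorem quasiMeasurePreserving_of_differentiable (f : ℝ ≃o ℝ) (hf : Differentiable ℝ f.symm) :
    Measure.QuasiMeasurePreserving f volume volume := by
  refine ⟨f.continuous.measurable, Measure.AbsolutelyContinuous.mk fun s hs h0 => ?_⟩
  rw [Measure.map_apply f.continuous.measurable hs,
    show f ⁻¹' s = f.symm '' s from (f.symm.toEquiv.image_eq_preimage_symm s).symm]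
  exact addHaar_image_eq_zero_of_differentiableOn_of_addHaar_eq_zero volume
    hf.differentiableOn h0

theorem quasiMeasurePreserving (h : IsClock lam P) :
    Measure.QuasiMeasurePreserving P volume volume :=
  quasiMeasurePreserving_of_differentiable P fun s => (h.hasDerivAt_symm s).differentiableAt

theorem quasiMeasurePreserving_symm (h : IsClock lam P) :
    Measure.QuasiMeasurePreserving P.symm volume volume :=
  quasiMeasurePreserving_of_differentiable P.symm fun s => (h.hasDerivAt s).differentiableAt

/-- A property that holds almost everywhere on `(0, ∞)` holds at `P.symm s` for almost every
`s > 0`. -/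
theorem ae_symm (h : IsClock lam P) {p : ℝ → Prop} (hp : ∀ᵐ ξ ∂halfLine, p ξ) :
    ∀ᵐ s, 0 < s → p (P.symm s) := by
  rw [ae_restrict_iff' measurableSet_Ioi] at hp
  filter_upwards [h.quasiMeasurePreserving_symm.ae hp] with s hs h0
  exact hs (h.symm_pos h0)

theorem ae_comp (h : IsClock lam P) {p : ℝ → Prop} (hp : ∀ᵐ s, p s) :
    ∀ᵐ ξ ∂halfLine, p (P ξ) :=
  ae_restrict_of_ae (h.quasiMeasurePreserving.ae hp)

theorem lintegral_Ioi (h : IsClock lam P) (u : ℝ → ℝ≥0∞) :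
    ∫⁻ s in Ioi 0, u s = ∫⁻ ξ in Ioi 0, ENNReal.ofReal (lam ξ)⁻¹ * u (P ξ) := by
  have h1 := lintegral_image_eq_lintegral_deriv_mul_of_monotoneOn (s := Ioi 0) measurableSet_Ioi
    (fun ξ _ => (h.hasDerivAt ξ).hasDerivWithinAt) (P.monotone.monotoneOn _) u
  rw [h.image_Ioi] at h1
  rw [h1]
  refine setLIntegral_congr_fun measurableSet_Ioi fun ξ hξ => ?_
  simp only [max_eq_left (le_of_lt (mem_Ioi.1 hξ))]

/-- The isometry: |λf|² ds = λ²|f|² dξ/λ = λ|f|² dξ. -/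
theorem lintegral_pull (h : IsClock lam P) (f : ℝ → ℂ) :
    ∫⁻ s, ‖(Ioi (0 : ℝ)).indicator (fun s => (lam (P.symm s) : ℂ)) s * f (P.symm s)‖ₑ ^ 2 =
      ∫⁻ ξ, ‖f ξ‖ₑ ^ 2 ∂weighted lam := by
  have h1 : ∀ s, ‖(Ioi (0 : ℝ)).indicator (fun s => (lam (P.symm s) : ℂ)) s *
      f (P.symm s)‖ₑ ^ 2 =
      (Ioi (0 : ℝ)).indicator (fun s => ‖(lam (P.symm s) : ℂ) * f (P.symm s)‖ₑ ^ 2) s := fun s => by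
    by_cases hs : s ∈ Ioi (0 : ℝ) <;> simp [hs]
  simp only [h1]
  rw [lintegral_indicator measurableSet_Ioi, h.lintegral_Ioi, lintegral_weighted h.continuousOn]
  refine setLIntegral_congr_fun measurableSet_Ioi fun ξ hξ => ?_
  have hp := h.pos ξ (le_of_lt hξ)
  have hn : ‖(lam ξ : ℂ)‖ₑ = ENNReal.ofReal (lam ξ) := by
    rw [← ofReal_norm, Complex.norm_of_nonneg hp.le]
  simp only [P.symm_apply_apply, enorm_mul, mul_pow, hn]
  rw [← mul_assoc, sq, ← mul_assoc, ← ENNReal.ofReal_mul (inv_nonneg.2 hp.le),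
    inv_mul_cancel₀ hp.ne', ENNReal.ofReal_one, one_mul]

theorem lintegral_push (h : IsClock lam P) (g : ℝ → ℂ) :
    ∫⁻ ξ, ‖((lam ξ)⁻¹ : ℂ) * g (P ξ)‖ₑ ^ 2 ∂weighted lam = ∫⁻ s in Ioi 0, ‖g s‖ₑ ^ 2 := by
  rw [h.lintegral_Ioi, lintegral_weighted h.continuousOn]
  refine setLIntegral_congr_fun measurableSet_Ioi fun ξ hξ => ?_
  have hp := h.pos ξ (le_of_lt hξ)
  have hn : ‖((lam ξ)⁻¹ : ℂ)‖ₑ = ENNReal.ofReal (lam ξ)⁻¹ := by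
    rw [← ofReal_norm, ← Complex.ofReal_inv, Complex.norm_of_nonneg (inv_nonneg.2 hp.le)]
  simp only [enorm_mul, mul_pow, hn]
  rw [← mul_assoc, sq, ← mul_assoc, ← ENNReal.ofReal_mul hp.le,
    mul_inv_cancel₀ hp.ne', ENNReal.ofReal_one, one_mul]

theorem exists_pull (h : IsClock lam P) :
    ∃ E : L2 lam →L[ℂ] Lp ℂ 2 (volume : Measure ℝ), ∀ x, ∀ᵐ s, E x s =
      (Ioi (0 : ℝ)).indicator (fun s => (lam (P.symm s) : ℂ)) s * x (P.symm s) := by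
  refine exists_weightedComp P.symm.continuous.measurable ?_ (fun p hp => ?_)
    fun f => (h.lintegral_pull f).le
  · have hm : Measurable ((Ioi (0 : ℝ)).indicator fun s => (lam (max (P.symm s) 0) : ℂ)) :=
      (Complex.continuous_ofReal.comp ((continuous_max_zero h.continuousOn).comp
        P.symm.continuous)).measurable.indicator measurableSet_Ioi
    have hcongr : (Ioi (0 : ℝ)).indicator (fun s => (lam (P.symm s) : ℂ)) =
        (Ioi (0 : ℝ)).indicator fun s => (lam (max (P.symm s) 0) : ℂ) :=
      indicator_congr fun s hs => by rw [max_eq_left (h.symm_pos hs).le]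
    rw [hcongr]
    exact hm.aestronglyMeasurable
  -- The weighted measure says nothing about negative ξ, but the multiplier vanishes there.
  · filter_upwards [h.ae_symm (ac_weighted h.continuousOn h.pos hp)] with s hs h0
    refine hs ?_
    by_contra h1
    exact h0 (indicator_of_notMem h1 _)

theorem exists_push (h : IsClock lam P) :
    ∃ R : Lp ℂ 2 (volume : Measure ℝ) →L[ℂ] L2 lam, ∀ g, ∀ᵐ ξ ∂weighted lam, R g ξ =
      ((lam ξ)⁻¹ : ℂ) * g (P ξ) := by
  refine exists_weightedComp P.continuous.measurable ?_ (fun p hp => ?_) fun g => ?_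
  · have hm : Measurable fun ξ => ((lam (max ξ 0))⁻¹ : ℂ) :=
      (Complex.continuous_ofReal.comp (continuous_max_zero h.continuousOn)).measurable.inv
    refine ⟨_, hm.stronglyMeasurable, weighted_ac ?_⟩
    filter_upwards [ae_restrict_mem measurableSet_Ioi] with ξ hξ
    rw [max_eq_left (le_of_lt (mem_Ioi.1 hξ))]
  · filter_upwards [weighted_ac (h.ae_comp hp)] with ξ hξ _ using hξ
  · rw [h.lintegral_push]
    exact setLIntegral_le_lintegral _ _

/-! ### Passage between L²_λ(0, ∞) and L²(ℝ) -/

/-- The isometric embedding `x ↦ (lam x) ∘ P⁻¹` of the weighted space into `L²(ℝ)`, with value `0`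
on the negative axis. -/
noncomputable def pull (h : IsClock lam P) : L2 lam →L[ℂ] Lp ℂ 2 (volume : Measure ℝ) :=
  h.exists_pull.choose

/-- The left inverse `g ↦ lam⁻¹ (g ∘ P)` of `IsClock.pull`. -/
noncomputable def push (h : IsClock lam P) : Lp ℂ 2 (volume : Measure ℝ) →L[ℂ] L2 lam :=
  h.exists_push.choose

theorem pull_ae (h : IsClock lam P) {x : L2 lam} {f : ℝ → ℂ} (hf : ∀ᵐ ξ ∂halfLine, f ξ = x ξ) :
    ∀ᵐ s, 0 < s → h.pull x s = lam (P.symm s) * f (P.symm s) := by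
  filter_upwards [h.exists_pull.choose_spec x, h.ae_symm hf] with s h1 h2 h0
  rw [pull, h1, indicator_of_mem (mem_Ioi.2 h0), h2 h0]

theorem push_ae (h : IsClock lam P) (g : Lp ℂ 2 (volume : Measure ℝ)) :
    ∀ᵐ ξ ∂halfLine, h.push g ξ = ((lam ξ)⁻¹ : ℂ) * g (P ξ) :=
  ac_weighted h.continuousOn h.pos (h.exists_push.choose_spec g)

theorem pull_comp_ae (h : IsClock lam P) (x : L2 lam) :
    ∀ᵐ ξ ∂halfLine, h.pull x (P ξ) = lam ξ * x ξ := by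
  filter_upwards [h.ae_comp (h.pull_ae (x := x) (Eventually.of_forall fun _ => rfl)),
    ae_restrict_mem measurableSet_Ioi] with ξ h1 h2
  rw [h1 (h.map_pos h2), P.symm_apply_apply]

/-- Functions in the weighted space are integrable on bounded intervals, and the integrals can be
computed after the change of variables. -/
theorem intervalIntegral_pull (h : IsClock lam P) (x : L2 lam) {a b : ℝ} (ha : 0 ≤ a)
    (hb : 0 ≤ b) : IntervalIntegrable x volume a b ∧
      ∫ ξ in a..b, x ξ = ∫ s in P a..P b, h.pull x s := by
  wlog hab : a ≤ b generalizing a b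
  · obtain ⟨h1, h2⟩ := this hb ha (le_of_not_ge hab)
    refine ⟨h1.symm, ?_⟩
    rw [intervalIntegral.integral_symm, h2, intervalIntegral.integral_symm (P a), neg_neg]
  -- The Jacobian λ⁻¹ cancels the factor λ inside `pull`, so no weight remains in the integral
  -- identity.
  have hae : ∀ᵐ ξ ∂volume.restrict (Ioc a b), (lam (max ξ 0))⁻¹ • h.pull x (P ξ) = x ξ := by
    have h1 := (ae_restrict_iff' measurableSet_Ioi).1 (h.pull_comp_ae x)
    rw [ae_restrict_iff' measurableSet_Ioc]
    filter_upwards [h1] with ξ h2 hξ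
    have h0 : 0 < ξ := ha.trans_lt hξ.1
    rw [h2 h0, max_eq_left h0.le, Complex.real_smul, Complex.ofReal_inv, ← mul_assoc,
      inv_mul_cancel₀ (h.lam_ne_zero h0.le), one_mul]
  have hd : ∀ ξ ∈ Ioc a b, HasDerivWithinAt P (lam (max ξ 0))⁻¹ (Ioc a b) ξ :=
    fun ξ _ => (h.hasDerivAt ξ).hasDerivWithinAt
  have hint : IntegrableOn (h.pull x) (P '' Ioc a b) := by
    rw [P.image_Ioc]
    exact ((locallyIntegrable_Lp _).integrableOn_isCompact isCompact_Icc).mono_set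
      Ioc_subset_Icc_self
  constructor
  · rw [intervalIntegrable_iff_integrableOn_Ioc_of_le hab]
    exact ((integrableOn_image_iff_integrableOn_deriv_smul_of_monotoneOn measurableSet_Ioc hd
      (P.monotone.monotoneOn _) _).1 hint).congr hae
  · rw [intervalIntegral.integral_of_le hab, intervalIntegral.integral_of_le (P.monotone hab),
      ← P.image_Ioc, integral_image_eq_integral_deriv_smul_of_monotoneOn measurableSet_Ioc hd
      (P.monotone.monotoneOn _)]
    exact (integral_congr_ae hae).symm

end IsClock

/-! ### The transport semigroup -/

namespace IsClock

variable {lam : ℝ → ℝ} {P : ℝ ≃o ℝ}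

/-- The transport semigroup: the left translation, conjugated by the change of variables `P`. -/
noncomputable def flow (h : IsClock lam P) (t : ℝ≥0) : L2 lam →L[ℂ] L2 lam :=
  h.push.comp ((translation t).comp h.pull)

theorem flow_ae (h : IsClock lam P) (t : ℝ≥0) {x : L2 lam} {f : ℝ → ℂ}
    (hf : ∀ᵐ ξ ∂halfLine, f ξ = x ξ) :
    ∀ᵐ ξ ∂halfLine, h.flow t x ξ =
      ((lam ξ)⁻¹ : ℂ) * (lam (P.symm (P ξ + t)) * f (P.symm (P ξ + t))) := by
  have h1 := (measurePreserving_add_right volume (t : ℝ)).quasiMeasurePreserving.ae (h.pull_ae hf)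
  filter_upwards [h.push_ae (translation t (h.pull x)), h.ae_comp (translation_ae t (h.pull x)),
    h.ae_comp h1, ae_restrict_mem measurableSet_Ioi] with ξ h2 h3 h4 h5
  rw [flow, ContinuousLinearMap.comp_apply, ContinuousLinearMap.comp_apply, h2, h3,
    h4 (add_pos_of_pos_of_nonneg (h.map_pos h5) t.coe_nonneg)]

/-- The restriction to s > 0 is essential: the translate may be nonzero on (-t, 0), whereas `pull`
of any element vanishes there. -/
theorem pull_flow_ae (h : IsClock lam P) (t : ℝ≥0) (x : L2 lam) :
    ∀ᵐ s, 0 < s → h.pull (h.flow t x) s = h.pull x (s + t) := by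
  have h1 : ∀ᵐ ξ ∂halfLine, ((lam ξ)⁻¹ : ℂ) * translation t (h.pull x) (P ξ) = h.flow t x ξ := by
    filter_upwards [h.push_ae (translation t (h.pull x))] with ξ h2 using h2.symm
  filter_upwards [h.pull_ae h1, translation_ae t (h.pull x)] with s h2 h3 h0
  rw [h2 h0, P.apply_symm_apply, ← mul_assoc,
    mul_inv_cancel₀ (h.lam_ne_zero (h.symm_pos h0).le), one_mul, h3]

theorem isC0Semigroup_flow (h : IsClock lam P) : IsC0Semigroup h.flow where
  map_zero := by
    ext1 x
    refine Lp.ext (weighted_ac ?_)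
    filter_upwards [h.flow_ae 0 (x := x) (Eventually.of_forall fun _ => rfl),
      ae_restrict_mem measurableSet_Ioi] with ξ h1 h2
    rw [h1, NNReal.coe_zero, add_zero, P.symm_apply_apply, ← mul_assoc,
      inv_mul_cancel₀ (h.lam_ne_zero (le_of_lt h2)), one_mul, ContinuousLinearMap.id_apply]
  map_add s t := by
    ext1 x
    refine Lp.ext (weighted_ac ?_)
    have hf : ∀ᵐ ξ ∂halfLine, x ξ = x ξ := Eventually.of_forall fun _ => rfl
    -- `flow_ae` accepts any representative; the explicit formula for `flow t x` is fed into it, and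
    -- the inner factors of λ cancel.
    have h1 : ∀ᵐ ξ ∂halfLine, ((lam ξ)⁻¹ : ℂ) *
        (lam (P.symm (P ξ + t)) * x (P.symm (P ξ + t))) = h.flow t x ξ := by
      filter_upwards [h.flow_ae t hf] with ξ h2 using h2.symm
    filter_upwards [h.flow_ae (s + t) hf, h.flow_ae s h1, ae_restrict_mem measurableSet_Ioi]
      with ξ h2 h3 h4
    have hpos := h.symm_pos (add_pos_of_pos_of_nonneg (h.map_pos h4) s.coe_nonneg)
    rw [h2, ContinuousLinearMap.comp_apply, h3, P.apply_symm_apply, NNReal.coe_add, add_assoc,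
      mul_inv_cancel_left₀ (h.lam_ne_zero hpos.le)]
  continuous_orbit x :=
    h.push.continuous.comp ((continuous_translation (h.pull x)).comp NNReal.continuous_coe)

/-! ### The transport operator is contained in the generator -/

theorem enorm_quotient_sub_le (h : IsClock lam P) {x z : L2 lam} {y : ℝ → ℂ}
    (hy : ∀ᵐ ξ ∂halfLine, y ξ = (lam ξ : ℂ) * x ξ)
    (hyz : ∀ a b : ℝ, 0 ≤ a → a ≤ b → y b - y a = ∫ ξ in a..b, z ξ)
    {t : ℝ≥0} (ht : 0 < t) {C : ℝ≥0∞}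
    (hC : ∀ r ∈ Ioc 0 (t : ℝ), ‖translation r (h.pull z) - h.pull z‖ₑ ^ 2 ≤ C) :
    ‖((t : ℝ)⁻¹ : ℂ) • (h.flow t x - x) - z‖ₑ ^ 2 ≤ C := by
  have ht' : (0 : ℝ) < t := ht
  have htc : ((t : ℝ) : ℂ) ≠ 0 := Complex.ofReal_ne_zero.2 ht'.ne'
  let w : ℝ → ℂ := fun s => h.pull z s
  have hwi : ∀ a b, IntervalIntegrable w volume a b := fun a b =>
    ((locallyIntegrable_Lp (h.pull z)).integrableOn_isCompact isCompact_uIcc).intervalIntegrable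
  let g : ℝ → ℂ := fun s => ((t : ℝ) : ℂ)⁻¹ * ∫ r in (0 : ℝ)..t, (w (s + r) - w s)
  have hf : ∀ᵐ ξ ∂halfLine, ((lam ξ)⁻¹ : ℂ) * y ξ = x ξ := by
    filter_upwards [hy, ae_restrict_mem measurableSet_Ioi] with ξ h1 h2
    rw [h1, inv_mul_cancel_left₀ (h.lam_ne_zero (le_of_lt h2))]
  have hd : ∀ᵐ ξ ∂halfLine, (((t : ℝ)⁻¹ : ℂ) • (h.flow t x - x) - z : L2 lam) ξ =
      ((lam ξ)⁻¹ : ℂ) * g (P ξ) := by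
    have hac := ac_weighted h.continuousOn h.pos
    filter_upwards [h.flow_ae t hf, hf, h.pull_comp_ae z, ae_restrict_mem measurableSet_Ioi,
      hac (Lp.coeFn_sub (((t : ℝ)⁻¹ : ℂ) • (h.flow t x - x)) z),
      hac (Lp.coeFn_smul ((t : ℝ)⁻¹ : ℂ) (h.flow t x - x)),
      hac (Lp.coeFn_sub (h.flow t x) x)] with ξ h1 h2 h3 h4 h5 h6 h7
    have hξ : (0 : ℝ) < ξ := h4
    have hη := h.symm_pos (add_pos_of_pos_of_nonneg (h.map_pos hξ) t.coe_nonneg)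
    have hle : ξ ≤ P.symm (P ξ + t) := by
      rw [P.le_symm_apply]
      exact le_add_of_nonneg_right t.coe_nonneg
    -- Along the characteristic from ξ to η = P⁻¹(P ξ + t), the increment y(η) - y(ξ) = ∫ z becomes
    -- ∫_0^t w(P ξ + r) dr.
    have hg : g (P ξ) = ((t : ℝ) : ℂ)⁻¹ * (y (P.symm (P ξ + t)) - y ξ) - lam ξ * z ξ := by
      simp only [g]
      have hwi' : IntervalIntegrable (fun r => w (P ξ + r)) volume 0 t := by
        simpa using (hwi (P ξ) (P ξ + t)).comp_add_left (P ξ)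
      rw [intervalIntegral.integral_sub hwi' intervalIntegrable_const,
        intervalIntegral.integral_comp_add_left (fun r => w r), intervalIntegral.integral_const,
        hyz _ _ hξ.le hle, (h.intervalIntegral_pull z hξ.le hη.le).2, P.apply_symm_apply, add_zero,
        sub_zero, mul_sub, Complex.real_smul, inv_mul_cancel_left₀ htc]
      simp only [w, h3]
    rw [h5, Pi.sub_apply, h6, Pi.smul_apply, h7, Pi.sub_apply, h1, ← h2, hg,
      mul_inv_cancel_left₀ (h.lam_ne_zero hη.le), mul_sub,
      inv_mul_cancel_left₀ (h.lam_ne_zero hξ.le), smul_eq_mul]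
    ring
  rw [enorm_sq_eq_lintegral, lintegral_congr_ae (g := fun ξ => ‖((lam ξ)⁻¹ : ℂ) * g (P ξ)‖ₑ ^ 2)
    (weighted_ac (hd.mono fun ξ hξ => by simp only [hξ])), h.lintegral_push]
  refine (setLIntegral_le_lintegral _ _).trans
    (lintegral_average_translate_le (Lp.stronglyMeasurable _).measurable ht' fun r hr => ?_)
  refine le_trans (le_of_eq ?_) (hC r hr)
  rw [enorm_sq_eq_lintegral]
  refine lintegral_congr_ae ?_
  filter_upwards [Lp.coeFn_sub (translation r (h.pull z)) (h.pull z),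
    translation_ae r (h.pull z)] with s h1 h2
  rw [h1, Pi.sub_apply, h2]

theorem tendsto_quotient (h : IsClock lam P) {x z : L2 lam} {y : ℝ → ℂ}
    (hy : ∀ᵐ ξ ∂halfLine, y ξ = (lam ξ : ℂ) * x ξ)
    (hyz : ∀ a b : ℝ, 0 ≤ a → a ≤ b → y b - y a = ∫ ξ in a..b, z ξ) :
    Tendsto (fun t : ℝ≥0 => ((t : ℝ)⁻¹ : ℂ) • (h.flow t x - x)) (𝓝[>] 0) (𝓝 z) := by
  rw [Metric.tendsto_nhds]
  intro ε hε
  -- The bound C is (ε/2)², valid for t < δ with δ the modulus of continuity of the translations at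
  -- 0.
  have hcont := (continuous_translation (h.pull z)).tendsto 0
  rw [translation_zero, Metric.tendsto_nhds] at hcont
  obtain ⟨δ, hδ, hball⟩ := Metric.eventually_nhds_iff.1 (hcont (ε / 2) (half_pos hε))
  have hδt : ∀ᶠ t : ℝ≥0 in 𝓝[>] 0, (t : ℝ) < δ :=
    mem_nhdsWithin_of_mem_nhds ((continuous_induced_dom.tendsto (0 : ℝ≥0)).eventually
      (gt_mem_nhds (by simpa using hδ)))
  filter_upwards [hδt, self_mem_nhdsWithin] with t h1 h2
  have hle := h.enorm_quotient_sub_le hy hyz (t := t) h2 (C := ENNReal.ofReal (ε / 2) ^ 2) ?_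
  · rw [ENNReal.pow_le_pow_left_iff two_ne_zero, ← ofReal_norm,
      ENNReal.ofReal_le_ofReal_iff (half_pos hε).le] at hle
    rw [dist_eq_norm]
    exact hle.trans_lt (half_lt_self hε)
  · intro r hr
    have hb := hball (y := r) (by rw [Real.dist_0_eq_abs, abs_of_pos hr.1]; exact hr.2.trans_lt h1)
    rw [dist_eq_norm] at hb
    rw [ENNReal.pow_le_pow_left_iff two_ne_zero, ← ofReal_norm]
    exact ENNReal.ofReal_le_ofReal hb.le

/-! ### The generator is contained in the transport operator -/

/-- Integration over [a, b] is continuous on L², so it commutes with the limit. Since a ≥ 0, only s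
> 0 matters, where `flow` acts as translation; the integrals telescope to difference quotients at
the two ends. -/
theorem integral_eq_sub_of_tendsto (h : IsClock lam P) {x z : L2 lam}
    (hz : Tendsto (fun t : ℝ≥0 => ((t : ℝ)⁻¹ : ℂ) • (h.flow t x - x)) (𝓝[>] 0) (𝓝 z))
    {a b : ℝ} (ha : 0 ≤ a) (hab : a ≤ b)
    (hda : HasDerivAt (fun r => ∫ s in (0 : ℝ)..r, h.pull x s) (h.pull x a) a)
    (hdb : HasDerivAt (fun r => ∫ s in (0 : ℝ)..r, h.pull x s) (h.pull x b) b) :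
    h.pull x b - h.pull x a = ∫ s in a..b, h.pull z s := by
  have hwi : ∀ u : L2 lam, ∀ a b, IntervalIntegrable (h.pull u) volume a b := fun u a b =>
    ((locallyIntegrable_Lp (h.pull u)).integrableOn_isCompact isCompact_uIcc).intervalIntegrable
  let V : ℝ → ℂ := fun r => ∫ s in (0 : ℝ)..r, h.pull x s
  have hF := ((continuous_intervalIntegral_Lp hab).comp h.pull.continuous).tendsto z |>.comp hz
  have hcoe : Tendsto (fun t : ℝ≥0 => (t : ℝ)) (𝓝[>] 0) (𝓝[≠] 0) := by
    refine tendsto_nhdsWithin_iff.2 ⟨(NNReal.continuous_coe.tendsto 0).mono_left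
      nhdsWithin_le_nhds, ?_⟩
    filter_upwards [self_mem_nhdsWithin] with t ht
    exact (NNReal.coe_pos.2 ht).ne'
  have hG := ((hasDerivAt_iff_tendsto_slope_zero.1 hdb).sub
    (hasDerivAt_iff_tendsto_slope_zero.1 hda)).comp hcoe
  refine tendsto_nhds_unique hG (hF.congr fun t => ?_)
  have h1 : ∫ s in a..b, h.pull (((t : ℝ)⁻¹ : ℂ) • (h.flow t x - x)) s =
      ((t : ℝ)⁻¹ : ℂ) * ∫ s in a..b, (h.pull x (s + t) - h.pull x s) := by
    rw [← intervalIntegral.integral_const_mul]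
    refine intervalIntegral.integral_congr_ae ?_
    rw [map_smul, map_sub]
    filter_upwards [Lp.coeFn_smul ((t : ℝ)⁻¹ : ℂ) (h.pull (h.flow t x) - h.pull x),
      Lp.coeFn_sub (h.pull (h.flow t x)) (h.pull x), h.pull_flow_ae t x] with s h1 h2 h3 hs
    rw [uIoc_of_le hab] at hs
    rw [h1, Pi.smul_apply, h2, Pi.sub_apply, h3 (ha.trans_lt hs.1), smul_eq_mul]
  have hwi' : IntervalIntegrable (fun s => h.pull x (s + t)) volume a b := by
    simpa using (hwi x (a + t) (b + t)).comp_add_right (t : ℝ)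
  have h2 : ∫ s in a..b, (h.pull x (s + t) - h.pull x s) =
      (V (b + t) - V b) - (V (a + t) - V a) := by
    rw [intervalIntegral.integral_sub hwi' (hwi x a b),
      intervalIntegral.integral_comp_add_right (fun s => h.pull x s)]
    simp only [V, intervalIntegral.integral_interval_sub_left (hwi x 0 _) (hwi x 0 _)]
    have e1 := intervalIntegral.integral_add_adjacent_intervals (hwi x a b) (hwi x b (b + t))
    have e2 := intervalIntegral.integral_add_adjacent_intervals (hwi x a (a + t))
      (hwi x (a + t) (b + t))
    linear_combination e2 - e1
  simp only [Function.comp_apply]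
  rw [h1, h2, mul_sub, Complex.real_smul, Complex.real_smul, Complex.ofReal_inv]

theorem mem_graph_of_tendsto (h : IsClock lam P) {x z : L2 lam}
    (hz : Tendsto (fun t : ℝ≥0 => ((t : ℝ)⁻¹ : ℂ) • (h.flow t x - x)) (𝓝[>] 0) (𝓝 z)) :
    (x, z) ∈ (transportOperator lam h.continuousOn h.pos).graph := by
  have hL := LocallyIntegrable.ae_hasDerivAt_integral (locallyIntegrable_Lp (h.pull x))
  have hLP := h.ae_comp hL
  have hne : (ae halfLine).NeBot := by
    rw [ae_neBot, Ne, Measure.restrict_eq_zero, Real.volume_Ioi]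
    exact ENNReal.top_ne_zero
  -- The base point needs `P c` to be a point of differentiability, so that `pull x (P c)` is the
  -- correct constant; 0 itself need not qualify.
  obtain ⟨c, hc, hc0⟩ := (hLP.and (ae_restrict_mem measurableSet_Ioi)).exists
  have hc0 : (0 : ℝ) < c := hc0
  have hi : ∀ a b : ℝ, 0 ≤ a → 0 ≤ b → IntervalIntegrable z volume a b := fun a b ha hb =>
    (h.intervalIntegral_pull z ha hb).1
  rw [mem_graph_transportOperator]
  refine ⟨fun r => h.pull x (P c) + ∫ ξ in c..r, z ξ, fun a b hab hI => ?_, ?_, ?_⟩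
  · have ha : 0 ≤ a := hI (left_mem_Icc.2 hab)
    have h1 := absolutelyContinuousOnInterval_integral
      (hi 0 (max b c) le_rfl (hc0.le.trans (le_max_right _ _))) (c := c)
      (by rw [uIcc_of_le (hc0.le.trans (le_max_right _ _))]; exact ⟨hc0.le, le_max_right _ _⟩)
    -- [0, max b c] contains both [a, b] and the base point c.
    refine AbsolutelyContinuousOnInterval.mono (a := 0) (b := max b c) ?_ ?_
    · have hconst : AbsolutelyContinuousOnInterval (fun _ => h.pull x (P c)) 0 (max b c) :=
        (contDiff_const (𝕜 := ℝ) (n := 1)).contDiffOn.absolutelyContinuousOnInterval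
      exact hconst.add h1
    · rw [uIcc_of_le hab, uIcc_of_le (hc0.le.trans (le_max_right _ _))]
      exact Icc_subset_Icc ha (le_max_left _ _)
  · filter_upwards [hLP, h.pull_comp_ae x, ae_restrict_mem measurableSet_Ioi] with ξ h1 h2 h3
    have hξ : (0 : ℝ) < ξ := h3
    rw [(h.intervalIntegral_pull z hc0.le hξ.le).2, ← h2]
    rcases le_total (P c) (P ξ) with hle | hle
    · rw [← h.integral_eq_sub_of_tendsto hz (h.map_nonneg hc0.le) hle (hc 0) (h1 0)]
      ring
    · rw [intervalIntegral.integral_symm,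
        ← h.integral_eq_sub_of_tendsto hz (h.map_nonneg hξ.le) hle (h1 0) (hc 0)]
      ring
  · have hn : ∀ n : ℕ, ∀ᵐ ξ, ξ ∈ uIcc (0 : ℝ) (max (n : ℝ) c) →
        HasDerivAt (fun r => ∫ s in c..r, z s) (z ξ) ξ := fun n => by
      have hm : (0 : ℝ) ≤ max (n : ℝ) c := hc0.le.trans (le_max_right _ _)
      filter_upwards [(hi 0 (max (n : ℝ) c) le_rfl hm).ae_hasDerivAt_integral] with ξ h1 h2
      exact h1 h2 c (by rw [uIcc_of_le hm]; exact ⟨hc0.le, le_max_right _ _⟩)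
    rw [ae_restrict_iff' measurableSet_Ioi]
    filter_upwards [ae_all_iff.2 hn] with ξ h1 h2
    obtain ⟨n, hn⟩ := exists_nat_ge ξ
    refine (HasDerivAt.const_add _ (h1 n ?_)).deriv
    rw [uIcc_of_le (hc0.le.trans (le_max_right _ _))]
    exact ⟨le_of_lt h2, hn.trans (le_max_left _ _)⟩

theorem isGeneratorOf_flow (h : IsClock lam P) :
    IsGeneratorOf (transportOperator lam h.continuousOn h.pos) h.flow := by
  refine fun x z => ⟨fun hxz => ?_, h.mem_graph_of_tendsto⟩
  obtain ⟨y, h1, h2, h3⟩ := (mem_graph_transportOperator h.continuousOn h.pos x z).1 hxz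
  refine h.tendsto_quotient h2 fun a b ha hab => ?_
  refine sub_eq_integral_of_ae_hasDerivAt
    (h1 a b hab fun r hr => ha.trans hr.1) (h.intervalIntegral_pull z ha (ha.trans hab)).1 ?_
  have h4 := h1.ae_differentiableAt
  rw [ae_restrict_iff' measurableSet_Ioi] at h3 h4
  -- When a = 0 the endpoint 0 lies in the interval but outside `Ioi 0`; it is discarded as a null
  -- set.
  filter_upwards [h3, h4, compl_mem_ae_iff.2 (measure_singleton (0 : ℝ))] with r h5 h6 h7 hr
  rw [uIcc_of_le hab] at hr
  have hr0 : r ∈ Ioi (0 : ℝ) := lt_of_le_of_ne (ha.trans hr.1) fun h0 => h7 h0.symm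
  rw [← h5 hr0]
  exact (h6 hr0).hasDerivAt

/-! ### Return to the travel time -/

theorem travelTimeInv_eq (h : IsClock lam P) (hP : ∀ ξ, 0 ≤ ξ → P ξ = travelTime lam ξ)
    (hbij : BijOn (travelTime lam) (Ici 0) (Ici 0)) {s : ℝ} (hs : 0 ≤ s) :
    travelTimeInv lam s = P.symm s := by
  have h1 : 0 ≤ P.symm s := by
    rw [P.le_symm_apply, h.map_zero]
    exact hs
  have hmem := hbij.surjOn (mem_Ici.2 hs)
  refine hbij.injOn (Function.invFunOn_mem hmem) h1 ?_
  have h2 : travelTime lam (travelTimeInv lam s) = s := Function.invFunOn_eq hmem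
  exact h2.trans (by rw [← hP _ h1, P.apply_symm_apply])

end IsClock

end WeightedTransport

theorem proposition4p2 (lam : ℝ → ℝ) (hc : ContinuousOn lam (Set.Ici 0))
    (hpos : ∀ ξ : ℝ, 0 ≤ ξ → 0 < lam ξ)
    (hint : ¬ MeasureTheory.IntegrableOn (fun ξ : ℝ => 1 / lam ξ) (Set.Ioi 0)
      MeasureTheory.volume) :
    Set.BijOn (WeightedTransport.travelTime lam) (Set.Ici 0) (Set.Ici 0) ∧
    ∃ T : ℝ≥0 → WeightedTransport.L2 lam →L[ℂ] WeightedTransport.L2 lam,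
      (∀ (t : ℝ≥0) (x : WeightedTransport.L2 lam) (f : ℝ → ℂ),
        (∀ᵐ ξ ∂WeightedTransport.halfLine, f ξ = x ξ) →
        ∀ᵐ ξ ∂WeightedTransport.halfLine, T t x ξ =
          ((lam (ξ + WeightedTransport.displacement lam ξ t) / lam ξ : ℝ) : ℂ) *
            f (ξ + WeightedTransport.displacement lam ξ t)) ∧
      WeightedTransport.IsC0Semigroup T ∧
      WeightedTransport.IsGeneratorOf (WeightedTransport.transportOperator lam hc hpos) T := by
  obtain ⟨P, h, hP⟩ := WeightedTransport.exists_isClock hc hpos hint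
  have hbij : BijOn (WeightedTransport.travelTime lam) (Ici 0) (Ici 0) := by
    have h1 : BijOn P (Ici 0) (P '' Ici 0) := P.injective.injOn.bijOn_image
    rw [P.image_Ici, h.map_zero] at h1
    exact h1.congr fun ξ hξ => hP ξ hξ
  refine ⟨hbij, h.flow, fun t x f hf => ?_, h.isC0Semigroup_flow, h.isGeneratorOf_flow⟩
  filter_upwards [h.flow_ae t hf, ae_restrict_mem measurableSet_Ioi] with ξ h1 h2
  have hd : ξ + WeightedTransport.displacement lam ξ t = P.symm (P ξ + t) := by
    rw [WeightedTransport.displacement, ← hP ξ (le_of_lt h2),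
      h.travelTimeInv_eq hP hbij (add_nonneg (h.map_pos h2).le t.coe_nonneg)]
    ring
  rw [h1, hd]
  push_cast
  ring
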